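/- For points $x_1,\dots,x_n\in\mathbb R^3$, write $x_i=(x_{i,1},x_{i,2},x_{i,3})$. For each pair $i<j$ choose complex numbers $z_{i,j},w_{i,j}$ with $|z_{i,j}|^2+|w_{i,j}|^2=1$ and $$\frac{z_{i,j}}{w_{i,j}}=\frac{(x_{j,1}-x_{i,1})+(x_{j,2}-x_{i,2})\sqrt{-1}}{\sqrt{\sum_{k=1}^3(x_{j,k}-x_{i,k})^2}-(x_{j,3}-x_{i,3})},$$ where $w_{i,j}=0$ if the denominator of the right-hand side vanishes. For $i>j$ put $z_{i,j}=-\overline{w_{j,i}}$ and $w_{i,j}=\overline{z_{j,i}}$. Let $a_{i,j}$ be the coefficient of $t_1^{j-1}t_2^{n-j}$ in the polynomial $f_i(t_1,t_2)=\prod_{k\ne i}(z_{i,k}t_1-w_{i,k}t_2)$. The Atiyah determinant is $D(x_1,\dots,x_n)=\det(a_{i,j})_{1\le i,j\le n}$; it does not depend on the choices made. Theorem. Let $x_1,x_2,x_3,x_4\in\mathbb R^3$ be the vertices, listed in any order, of a convex quadrilateral, that is, four coplanar points none of which lies in the convex hull of the other three. Then $$|D(x_1,x_2,x_3,x_4)|\ge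 1.$$ -/

import Mathlib

open scoped ComplexConjugate

noncomputable section

/-- Euclidean three-space. -/
abbrev E3 : Type := EuclideanSpace ℝ (Fin 3)

/-- Numerator of the stereographic coordinate of the direction from `p` to `q`. -/
def stereoNum (p q : E3) : ℂ :=
  ((q 0 - p 0 : ℝ) : ℂ) + ((q 1 - p 1 : ℝ) : ℂ) * Complex.I

/-- Denominator of the stereographic coordinate of the direction from `p` to `q`. -/
def stereoDen (p q : E3) : ℝ :=
  √(∑ k, (q k - p k) ^ 2) - (q 2 - p 2)

/-- `z` and `w` are admissible choices of the numbers `z i j`, `w i j` (`i ≠ j`) in the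
construction of the Atiyah determinant of the points `x`. For `i < j`, the pair
`(z i j, w i j)` is a unit vector in `ℂ²` with `z i j / w i j` equal to the stereographic
coordinate of the direction from `x i` to `x j` (with `w i j = 0` if the denominator of the latter
vanishes); the pair with the indices exchanged is then the antipodal one.
The values on the diagonal play no role. -/
structure IsAtiyahChoice {n : ℕ} (x : Fin n → E3) (z w : Fin n → Fin n → ℂ) : Prop where
  norm_eq : ∀ i j, i < j → ‖z i j‖ ^ 2 + ‖w i j‖ ^ 2 = 1
  of_den_eq_zero : ∀ i j, i < j → stereoDen (x i) (x j) = 0 → w i j = 0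
  of_den_ne_zero : ∀ i j, i < j → stereoDen (x i) (x j) ≠ 0 →
    w i j ≠ 0 ∧ z i j / w i j = stereoNum (x i) (x j) / (stereoDen (x i) (x j) : ℂ)
  z_swap : ∀ i j, i < j → z j i = -conj (w i j)
  w_swap : ∀ i j, i < j → w j i = conj (z i j)

/-- The polynomial `f_i(t₁, t₂) = ∏_{k ≠ i} (z_{i,k} t₁ - w_{i,k} t₂)`; the variables `t₁`, `t₂`
are `X 0`, `X 1`. -/
def atiyahPoly {n : ℕ} (z w : Fin n → Fin n → ℂ) (i : Fin n) : MvPolynomial (Fin 2) ℂ :=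
  ∏ k ∈ Finset.univ.erase i,
    (MvPolynomial.C (z i k) * MvPolynomial.X 0 - MvPolynomial.C (w i k) * MvPolynomial.X 1)

/-- The matrix of coefficients of the polynomials `f_i`. With indices starting from `0`, the entry
`(i, j)` is the coefficient of `f_i` at `t₁ ^ j * t₂ ^ (n - 1 - j)`. -/
def atiyahMatrix {n : ℕ} (z w : Fin n → Fin n → ℂ) : Matrix (Fin n) (Fin n) ℂ :=
  Matrix.of fun i j =>
    (atiyahPoly z w i).coeff (Finsupp.single 0 (j : ℕ) + Finsupp.single 1 (n - 1 - (j : ℕ)))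

theorem exists_isAtiyahChoice {n : ℕ} (x : Fin n → E3) :
    ∃ zw : (Fin n → Fin n → ℂ) × (Fin n → Fin n → ℂ), IsAtiyahChoice x zw.1 zw.2 := by
  have key : ∀ p q : E3, ∃ c : ℂ × ℂ, ‖c.1‖ ^ 2 + ‖c.2‖ ^ 2 = 1 ∧
      (stereoDen p q = 0 → c.2 = 0) ∧
      (stereoDen p q ≠ 0 → c.2 ≠ 0 ∧ c.1 / c.2 = stereoNum p q / (stereoDen p q : ℂ)) := by
    intro p q
    by_cases h : stereoDen p q = 0
    · exact ⟨(1, 0), by simp, by simp, fun h' => absurd h h'⟩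
    · set a := stereoNum p q
      set d := stereoDen p q
      have hpos : 0 < ‖a‖ ^ 2 + d ^ 2 := by positivity
      set s := √(‖a‖ ^ 2 + d ^ 2) with hs
      have hs0 : 0 < s := Real.sqrt_pos.2 hpos
      have hs2 : s ^ 2 = ‖a‖ ^ 2 + d ^ 2 := Real.sq_sqrt hpos.le
      have hsC : (s : ℂ) ≠ 0 := by exact_mod_cast hs0.ne'
      have hdC : (d : ℂ) ≠ 0 := by exact_mod_cast h
      refine ⟨(a / s, d / s), ?_, fun h' => absurd h' h, fun _ => ⟨div_ne_zero hdC hsC, ?_⟩⟩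
      · simp only [norm_div, Complex.norm_real, Real.norm_eq_abs, div_pow, sq_abs]
        rw [← add_div, ← hs2]
        exact div_self (by positivity)
      · field_simp
  choose c h1 h2 h3 using key
  refine ⟨(fun i j => if i < j then (c (x i) (x j)).1 else -conj (c (x j) (x i)).2,
    fun i j => if i < j then (c (x i) (x j)).2 else conj (c (x j) (x i)).1), ?_⟩
  constructor
  · intro i j hij; simpa [hij] using h1 _ _
  · intro i j hij; simpa [hij] using h2 _ _
  · intro i j hij; simpa [hij] using h3 _ _
  · intro i j hij; simp [hij, hij.asymm]
  · intro i j hij; simp [hij, hij.asymm]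

/-- The Atiyah determinant `D(x_1, …, x_n)`, computed from some admissible choice; by
`atiyahDet_eq` the choice is irrelevant. -/
def atiyahDet {n : ℕ} (x : Fin n → E3) : ℂ :=
  (atiyahMatrix (exists_isAtiyahChoice x).choose.1 (exists_isAtiyahChoice x).choose.2).det

/-- Two admissible choices differ by phases which cancel in the determinant. -/
theorem IsAtiyahChoice.det_eq {n : ℕ} {x : Fin n → E3} {z w z' w' : Fin n → Fin n → ℂ}
    (h : IsAtiyahChoice x z w) (h' : IsAtiyahChoice x z' w') :
    (atiyahMatrix z' w').det = (atiyahMatrix z w).det := by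
  have key : ∀ i j, ∃ u : ℂ, i < j →
      ‖u‖ = 1 ∧ z' i j = u * z i j ∧ w' i j = u * w i j := by
    intro i j
    by_cases hij : i < j
    swap
    · exact ⟨1, fun h => absurd h hij⟩
    have n1 := h.norm_eq i j hij
    have n2 := h'.norm_eq i j hij
    by_cases hd : stereoDen (x i) (x j) = 0
    · have e1 := h.of_den_eq_zero i j hij hd
      have e2 := h'.of_den_eq_zero i j hij hd
      rw [e1] at n1
      rw [e2] at n2
      have m1 : ‖z i j‖ = 1 := by
        rw [← sq_eq_sq₀ (norm_nonneg _) zero_le_one]; simpa using n1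
      have m2 : ‖z' i j‖ = 1 := by
        rw [← sq_eq_sq₀ (norm_nonneg _) zero_le_one]; simpa using n2
      have hz : z i j ≠ 0 := by
        intro h0; simp [h0] at m1
      exact ⟨z' i j / z i j, fun _ => ⟨by simp [m1, m2], by field_simp, by simp [e1, e2]⟩⟩
    · obtain ⟨a1, b1⟩ := h.of_den_ne_zero i j hij hd
      obtain ⟨a2, b2⟩ := h'.of_den_ne_zero i j hij hd
      set q := stereoNum (x i) (x j) / (stereoDen (x i) (x j) : ℂ)
      rw [div_eq_iff a1] at b1
      rw [div_eq_iff a2] at b2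
      rw [b1, norm_mul] at n1
      rw [b2, norm_mul] at n2
      have hq : ‖q‖ ^ 2 + 1 ≠ 0 := by positivity
      have hn : ‖w' i j‖ = ‖w i j‖ := by
        rw [← sq_eq_sq₀ (norm_nonneg _) (norm_nonneg _)]
        apply mul_left_cancel₀ hq
        linarith
      refine ⟨w' i j / w i j, fun _ => ⟨?_, ?_, by field_simp⟩⟩
      · rw [norm_div, hn, div_self (norm_ne_zero_iff.2 a1)]
      · rw [b1, b2]; field_simp
  choose u hu using key
  set v : Fin n → Fin n → ℂ := fun i j =>
    if i < j then u i j else if j < i then conj (u j i) else 1 with hv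
  have hzv : ∀ i j, i ≠ j → z' i j = v i j * z i j ∧ w' i j = v i j * w i j := by
    intro i j hij
    rcases lt_or_gt_of_ne hij with hlt | hlt
    · simpa [hv, hlt] using (hu i j hlt).2
    · obtain ⟨-, e1, e2⟩ := hu j i hlt
      simp only [hv, hlt, hlt.asymm, if_true, if_false, h.z_swap j i hlt, h.w_swap j i hlt,
        h'.z_swap j i hlt, h'.w_swap j i hlt, e1, e2, map_mul]
      exact ⟨by ring, trivial⟩
  have hvv : ∀ i j, v i j * v j i = 1 := by
    have aux : ∀ i j, i < j → v i j * v j i = 1 := by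
      intro i j hij
      simp only [hv, hij, hij.asymm, if_true, if_false]
      rw [Complex.mul_conj, Complex.normSq_eq_norm_sq, (hu i j hij).1]
      simp
    intro i j
    rcases lt_trichotomy i j with hlt | rfl | hlt
    · exact aux i j hlt
    · simp [hv]
    · rw [mul_comm]; exact aux j i hlt
  have hpoly : ∀ i, atiyahPoly z' w' i =
      MvPolynomial.C (∏ k ∈ Finset.univ.erase i, v i k) * atiyahPoly z w i := by
    intro i
    rw [atiyahPoly, atiyahPoly, map_prod, ← Finset.prod_mul_distrib]
    refine Finset.prod_congr rfl fun k hk => ?_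
    obtain ⟨e1, e2⟩ := hzv i k (Finset.ne_of_mem_erase hk).symm
    rw [e1, e2, map_mul, map_mul]
    ring
  have hmat : atiyahMatrix z' w' =
      Matrix.of fun i j => (∏ k ∈ Finset.univ.erase i, v i k) * atiyahMatrix z w i j := by
    ext i j
    simp only [atiyahMatrix, Matrix.of_apply, hpoly, MvPolynomial.coeff_C_mul]
  have hdiag : ∀ i, ∏ k ∈ Finset.univ.erase i, v i k = ∏ k, v i k := by
    intro i
    refine Finset.prod_erase _ ?_
    simp [hv]
  have hprod : ∏ i, ∏ k ∈ Finset.univ.erase i, v i k = 1 := by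
    simp_rw [hdiag]
    have e2 : ∀ i j, v i j = (if i < j then v i j else 1) * (if j < i then v j i else 1)⁻¹ := by
      intro i j
      rcases lt_trichotomy i j with hlt | rfl | hlt
      · simp [hlt, hlt.asymm]
      · simp [hv]
      · simp only [hlt, hlt.asymm, if_true, if_false, one_mul]
        exact eq_inv_of_mul_eq_one_left (hvv i j)
    have hne : ∀ i j, (if i < j then v i j else 1) ≠ 0 := by
      intro i j
      split_ifs
      · exact left_ne_zero_of_mul_eq_one (hvv i j)
      · exact one_ne_zero
    rw [Finset.prod_congr rfl fun i _ => Finset.prod_congr rfl fun j _ => e2 i j]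
    simp_rw [Finset.prod_mul_distrib, Finset.prod_inv_distrib]
    rw [Finset.prod_comm (f := fun i j => if j < i then v j i else 1)]
    exact mul_inv_cancel₀
      (Finset.prod_ne_zero_iff.2 fun i _ => Finset.prod_ne_zero_iff.2 fun j _ => hne i j)
  rw [hmat, Matrix.det_mul_column, hprod, one_mul]

/-- The Atiyah determinant may be computed from any admissible choice. -/
theorem atiyahDet_eq {n : ℕ} {x : Fin n → E3} {z w : Fin n → Fin n → ℂ}
    (h : IsAtiyahChoice x z w) : atiyahDet x = (atiyahMatrix z w).det :=
  h.det_eq (exists_isAtiyahChoice x).choose_spec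

/-- Four points of space are the vertices, listed in any order, of a (nondegenerate, planar) convex
quadrilateral: they lie in a common plane and none of them is in the convex hull of the other
three. -/
def AreVerticesOfConvexQuadrilateral (x : Fin 4 → E3) : Prop :=
  Coplanar ℝ (Set.range x) ∧ ConvexIndependent ℝ x

end

/-! A unit spinor `(z, w)` in `ℂ²` encodes a direction in space up to phase, and an element of
`SU(2)` acts on spinors as a rotation. The induced action on binary cubics has determinant one, so
the determinant does not change if the plane of the points is rotated to be horizontal. Every
direction in use then lies on the equator, and its spinor is a phase times `(u, 1) / √2` with `u` a
unit complex number. The twelve factors `1 / √2` give `1 / 64`, so the claim becomes a lower bound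
of `64` for a determinant built from planar directions (`IsAtiyahChoice.norm_det_eq`).

In the plane, Radon's theorem makes two of the segments joining the points cross, and these are the
diagonals. A relabelling and a similarity put one diagonal on the real axis and the crossing point
at `0`. In terms of the angles between sides and diagonals, the determinant is a unimodular number
times `64 + quadExcess` (`det_atiyahMatrix_of_angles`).

It remains to see that `quadExcess ≥ 0`. Each vertex contributes a nonnegative product of its own
angles with the triangle of the other three vertices. The single subtracted term measures the
failure of concyclicity, and the contributions of two opposite vertices dominate it
(`quadExcess_nonneg`). -/

/-! ### The trigonometric inequality. -/

/-- Sum of `4 cos²` of half the angles `p`, `q`, `p + q`. -/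
noncomputable def sumCosSq (p q : ℝ) : ℝ := 6 + 2 * (Real.cos p + Real.cos q + Real.cos (p + q))

/-- Eight times the product of the sines of the half angles of a triangle. -/
noncomputable def sinHalfProd (p q r : ℝ) : ℝ := 2 * (Real.cos p + Real.cos q + Real.cos r - 1)

theorem sinHalfProd_eq {p q r : ℝ} (h : p + q + r = Real.pi) :
    sinHalfProd p q r = 8 * (Real.sin (p / 2) * Real.sin (q / 2) * Real.sin (r / 2)) := by
  have hr : r / 2 = Real.pi / 2 - (p / 2 + q / 2) := by linarith
  have hr' : r = Real.pi - (2 * (p / 2) + 2 * (q / 2)) := by linarith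
  have hp : Real.cos p = Real.cos (2 * (p / 2)) := by congr 1; ring
  have hq : Real.cos q = Real.cos (2 * (q / 2)) := by congr 1; ring
  rw [sinHalfProd, hr, hp, hq, hr', Real.sin_pi_div_two_sub, Real.cos_pi_sub, Real.cos_add,
    Real.cos_add, Real.cos_two_mul, Real.cos_two_mul, Real.sin_two_mul, Real.sin_two_mul]
  have h1 := Real.sin_sq_add_cos_sq (p / 2)
  have h2 := Real.sin_sq_add_cos_sq (q / 2)
  set a := Real.sin (p / 2)
  set b := Real.cos (p / 2)
  set c := Real.sin (q / 2)
  set d := Real.cos (q / 2)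
  linear_combination (8 * c ^ 2) * h1 + (8 - 8 * b ^ 2) * h2

theorem sinHalfProd_nonneg {p q r : ℝ} (h : p + q + r = Real.pi) (hp : 0 ≤ p) (hq : 0 ≤ q)
    (hr : 0 ≤ r) : 0 ≤ sinHalfProd p q r := by
  have key : ∀ t, 0 ≤ t → t ≤ Real.pi → 0 ≤ Real.sin (t / 2) := fun t h0 h1 =>
    Real.sin_nonneg_of_nonneg_of_le_pi (by linarith) (by linarith)
  rw [sinHalfProd_eq h]
  have := key p hp (by linarith)
  have := key q hq (by linarith)
  have := key r hr (by linarith)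
  positivity

theorem four_le_sumCosSq {p q : ℝ} (hp : 0 ≤ p) (hq : 0 ≤ q) (h : p + q ≤ Real.pi) :
    4 ≤ sumCosSq p q := by
  have h1 := Real.cos_add_cos p q
  have h2 : 0 ≤ Real.cos ((p + q) / 2) :=
    Real.cos_nonneg_of_mem_Icc ⟨by linarith, by linarith⟩
  have h3 : 0 ≤ Real.cos ((p - q) / 2) :=
    Real.cos_nonneg_of_mem_Icc ⟨by linarith, by linarith⟩
  have h4 := Real.neg_one_le_cos (p + q)
  have := mul_nonneg h2 h3
  rw [sumCosSq]
  linarith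

/-- The excess over `64` of the planar four-point determinant, in terms of the angles
`a₁, a₂, b₁, …, d₂` between sides and diagonals of a quadrilateral. -/
noncomputable def quadExcess (a₁ a₂ b₁ b₂ c₁ c₂ d₁ d₂ : ℝ) : ℝ :=
  sumCosSq a₁ a₂ * sinHalfProd (c₁ + c₂) b₁ d₂ + sumCosSq c₁ c₂ * sinHalfProd (a₁ + a₂) b₂ d₁ +
    sumCosSq b₁ b₂ * sinHalfProd a₂ c₁ (d₁ + d₂) + sumCosSq d₁ d₂ * sinHalfProd a₁ c₂ (b₁ + b₂) -
    4 * sinHalfProd (b₂ - c₁) (b₁ - a₂) (Real.pi - (b₂ - c₁) - (b₁ - a₂))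

/-- For a quadrilateral `ABCD`, the index splits each vertex angle along its diagonal: `a₁ = CAB`,
`a₂ = DAC`, `b₁ = DBC`, `b₂ = ABD`, `c₁ = ACD`, `c₂ = ACB`, `d₁ = ADB`, `d₂ = BDC`. The differences
`x = b₂ - c₁` and `y = b₁ - a₂` vanish for concyclic vertices, by the inscribed angle theorem. When
both are nonnegative, the terms of `A` and `C` alone dominate the subtracted one. -/
theorem quadExcess_nonneg_of_le {a₁ a₂ b₁ b₂ c₁ c₂ d₁ d₂ : ℝ} (ha₁ : 0 ≤ a₁) (ha₂ : 0 ≤ a₂)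
    (hb₁ : 0 ≤ b₁) (hb₂ : 0 ≤ b₂) (hc₁ : 0 ≤ c₁) (hc₂ : 0 ≤ c₂) (hd₁ : 0 ≤ d₁) (hd₂ : 0 ≤ d₂)
    (hx : b₂ - c₁ = d₂ - a₁) (hy : b₁ - a₂ = d₁ - c₂) (h : a₁ + b₂ + (b₁ + c₂) = Real.pi)
    (hle : 0 ≤ Real.sin ((b₂ - c₁) / 2) * Real.sin ((b₁ - a₂) / 2) → 0 ≤ b₂ - c₁ ∧ 0 ≤ b₁ - a₂) :
    0 ≤ quadExcess a₁ a₂ b₁ b₂ c₁ c₂ d₁ d₂ := by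
  have n1 : 0 ≤ sumCosSq b₁ b₂ * sinHalfProd a₂ c₁ (d₁ + d₂) :=
    mul_nonneg (by linarith [four_le_sumCosSq hb₁ hb₂ (by linarith)])
      (sinHalfProd_nonneg (by linarith) ha₂ hc₁ (by linarith))
  have n2 : 0 ≤ sumCosSq d₁ d₂ * sinHalfProd a₁ c₂ (b₁ + b₂) :=
    mul_nonneg (by linarith [four_le_sumCosSq hd₁ hd₂ (by linarith)])
      (sinHalfProd_nonneg (by linarith) ha₁ hc₂ (by linarith))
  have fA := four_le_sumCosSq ha₁ ha₂ (by linarith)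
  have fC := four_le_sumCosSq hc₁ hc₂ (by linarith)
  have pA : 0 ≤ sinHalfProd (c₁ + c₂) b₁ d₂ :=
    sinHalfProd_nonneg (by linarith) (by linarith) hb₁ hd₂
  have pC : 0 ≤ sinHalfProd (a₁ + a₂) b₂ d₁ :=
    sinHalfProd_nonneg (by linarith) (by linarith) hb₂ hd₁
  have n3 := mul_le_mul_of_nonneg_right fA pA
  have n4 := mul_le_mul_of_nonneg_right fC pC
  have hpi := Real.pi_pos
  set x := b₂ - c₁ with hxdef
  set y := b₁ - a₂ with hydef
  have hlast := sinHalfProd_eq (p := x) (q := y) (r := Real.pi - x - y) (by ring)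
  have harg : (Real.pi - x - y) / 2 = (a₁ + a₂) / 2 + (c₁ + c₂) / 2 := by linarith
  have hs : 0 ≤ Real.sin ((Real.pi - x - y) / 2) :=
    Real.sin_nonneg_of_nonneg_of_le_pi (by linarith) (by linarith)
  rw [quadExcess]
  -- Since `x ≤ b₂, d₂` and `y ≤ b₁, d₁`, half-angle sines compare termwise. Subadditivity of sine
  -- then splits the third factor, whose half angle is half the sum of the angles at `A` and `C`. If
  -- the product of the first two sines is negative, the subtracted term is itself nonpositive.
  by_cases hxy : 0 ≤ Real.sin (x / 2) * Real.sin (y / 2)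
  · obtain ⟨x0, y0⟩ := hle hxy
    have mono : ∀ s t : ℝ, 0 ≤ s → s ≤ t → t ≤ Real.pi → Real.sin (s / 2) ≤ Real.sin (t / 2) :=
      fun s t h0 h1 h2 => Real.sin_le_sin_of_le_of_le_pi_div_two (by linarith) (by linarith)
        (by linarith)
    have sx : 0 ≤ Real.sin (x / 2) :=
      Real.sin_nonneg_of_nonneg_of_le_pi (by linarith) (by linarith)
    have sy : 0 ≤ Real.sin (y / 2) :=
      Real.sin_nonneg_of_nonneg_of_le_pi (by linarith) (by linarith)
    have sA : 0 ≤ Real.sin ((a₁ + a₂) / 2) :=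
      Real.sin_nonneg_of_nonneg_of_le_pi (by linarith) (by linarith)
    have sC : 0 ≤ Real.sin ((c₁ + c₂) / 2) :=
      Real.sin_nonneg_of_nonneg_of_le_pi (by linarith) (by linarith)
    have m1 : Real.sin (y / 2) * Real.sin (x / 2) ≤ Real.sin (b₁ / 2) * Real.sin (d₂ / 2) :=
      mul_le_mul (mono _ _ y0 (by linarith) (by linarith)) (mono _ _ x0 (by linarith)
        (by linarith)) sx (sy.trans (mono _ _ y0 (by linarith) (by linarith)))
    have m2 : Real.sin (x / 2) * Real.sin (y / 2) ≤ Real.sin (b₂ / 2) * Real.sin (d₁ / 2) :=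
      mul_le_mul (mono _ _ x0 (by linarith) (by linarith)) (mono _ _ y0 (by linarith)
        (by linarith)) sy (sx.trans (mono _ _ x0 (by linarith) (by linarith)))
    rw [sinHalfProd_eq (by linarith)] at n3 n4
    have k1 := mul_le_mul_of_nonneg_left m1 sC
    have k2 := mul_le_mul_of_nonneg_left m2 sA
    have k3 : Real.sin ((Real.pi - x - y) / 2) ≤
        Real.sin ((a₁ + a₂) / 2) + Real.sin ((c₁ + c₂) / 2) := by
      rw [harg, Real.sin_add]
      have := mul_le_mul_of_nonneg_left (Real.cos_le_one ((c₁ + c₂) / 2)) sA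
      have := mul_le_mul_of_nonneg_left (Real.cos_le_one ((a₁ + a₂) / 2)) sC
      linarith
    have k4 := mul_le_mul_of_nonneg_left k3 hxy
    rw [hlast, sinHalfProd_eq (show c₁ + c₂ + b₁ + d₂ = Real.pi by linarith),
      sinHalfProd_eq (show a₁ + a₂ + b₂ + d₁ = Real.pi by linarith)]
    linarith
  · have : Real.sin (x / 2) * Real.sin (y / 2) * Real.sin ((Real.pi - x - y) / 2) ≤ 0 :=
      mul_nonpos_of_nonpos_of_nonneg (not_le.1 hxy).le hs
    rw [hlast]
    linarith

/-- A cyclic shift of the vertices permutes the four positive terms and replaces `(x, y)` by `(-y,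
-x)`. The last term is unaffected because it is symmetric and `cos` is even. -/
theorem quadExcess_rotate {a₁ a₂ b₁ b₂ c₁ c₂ d₁ d₂ : ℝ} (hy : b₁ - a₂ = d₁ - c₂) :
    quadExcess b₁ b₂ c₁ c₂ d₁ d₂ a₁ a₂ = quadExcess a₁ a₂ b₁ b₂ c₁ c₂ d₁ d₂ := by
  have e1 : c₂ - d₁ = -(b₁ - a₂) := by linarith
  have e2 : c₁ - b₂ = -(b₂ - c₁) := by ring
  have e3 : sinHalfProd (c₂ - d₁) (c₁ - b₂) (Real.pi - (c₂ - d₁) - (c₁ - b₂)) =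
      sinHalfProd (b₂ - c₁) (b₁ - a₂) (Real.pi - (b₂ - c₁) - (b₁ - a₂)) := by
    rw [e1, e2, sinHalfProd, sinHalfProd, Real.cos_neg, Real.cos_neg, sub_sub, sub_sub,
      Real.cos_pi_sub, Real.cos_pi_sub, ← neg_add, Real.cos_neg, add_comm (b₁ - a₂)]
    ring
  rw [quadExcess, e3, quadExcess]
  simp only [sinHalfProd]
  ring

/-- If both differences are nonpositive, a cyclic shift makes them nonnegative. If their signs are
strictly opposite, the product of sines is negative, so the sign condition of
`quadExcess_nonneg_of_le` holds vacuously. -/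
theorem quadExcess_nonneg {a₁ a₂ b₁ b₂ c₁ c₂ d₁ d₂ : ℝ} (ha₁ : 0 ≤ a₁) (ha₂ : 0 ≤ a₂)
    (hb₁ : 0 ≤ b₁) (hb₂ : 0 ≤ b₂) (hc₁ : 0 ≤ c₁) (hc₂ : 0 ≤ c₂) (hd₁ : 0 ≤ d₁) (hd₂ : 0 ≤ d₂)
    (hx : b₂ - c₁ = d₂ - a₁) (hy : b₁ - a₂ = d₁ - c₂) (h : a₁ + b₂ + (b₁ + c₂) = Real.pi) :
    0 ≤ quadExcess a₁ a₂ b₁ b₂ c₁ c₂ d₁ d₂ := by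
  have hpi := Real.pi_pos
  have pos : ∀ t, 0 < t → t ≤ Real.pi → 0 < Real.sin (t / 2) := fun t h0 h1 =>
    Real.sin_pos_of_pos_of_lt_pi (by linarith) (by linarith)
  have neg : ∀ t, t < 0 → -Real.pi ≤ t → Real.sin (t / 2) < 0 := fun t h0 h1 =>
    Real.sin_neg_of_neg_of_neg_pi_lt (by linarith) (by linarith)
  by_cases hc : b₂ - c₁ ≤ 0 ∧ b₁ - a₂ ≤ 0
  · rw [← quadExcess_rotate hy]
    exact quadExcess_nonneg_of_le hb₁ hb₂ hc₁ hc₂ hd₁ hd₂ ha₁ ha₂ (by linarith) (by linarith)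
      (by linarith) fun _ => ⟨by linarith, by linarith⟩
  · refine quadExcess_nonneg_of_le ha₁ ha₂ hb₁ hb₂ hc₁ hc₂ hd₁ hd₂ hx hy h fun hs => ?_
    by_contra hn
    rcases lt_or_ge (b₂ - c₁) 0 with h1 | h1
    · have h2 : 0 < b₁ - a₂ := by
        by_contra h2; exact hc ⟨h1.le, not_lt.1 h2⟩
      have := mul_neg_of_neg_of_pos (neg _ h1 (by linarith)) (pos _ h2 (by linarith))
      linarith
    · have h2 : b₁ - a₂ < 0 := by
        by_contra h2; exact hn ⟨h1, not_lt.1 h2⟩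
      have h3 : 0 < b₂ - c₁ := by
        by_contra h3; exact hc ⟨not_lt.1 h3, h2.le⟩
      have := mul_neg_of_pos_of_neg (pos _ h3 (by linarith)) (neg _ h2 (by linarith))
      linarith

/-! ### Binary cubics: linear action, rescaling, relabelling. -/

/-- Coefficients of the binary cubic `∏ (zₖ t₁ - wₖ t₂)`. -/
noncomputable def cubicCoeff (z₁ w₁ z₂ w₂ z₃ w₃ : ℂ) : Fin 4 → ℂ :=
  ![-(w₁ * w₂ * w₃), z₁ * w₂ * w₃ + w₁ * z₂ * w₃ + w₁ * w₂ * z₃,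
    -(z₁ * z₂ * w₃ + z₁ * w₂ * z₃ + w₁ * z₂ * z₃), z₁ * z₂ * z₃]

open MvPolynomial in
theorem coeff_mul_linear_eq_cubicCoeff (z₁ w₁ z₂ w₂ z₃ w₃ : ℂ) (j : Fin 4) :
    ((C z₁ * X 0 - C w₁ * X 1) * ((C z₂ * X 0 - C w₂ * X 1) * (C z₃ * X 0 - C w₃ * X 1)) :
      MvPolynomial (Fin 2) ℂ).coeff (Finsupp.single 0 (j : ℕ) + Finsupp.single 1 (3 - (j : ℕ))) =
    cubicCoeff z₁ w₁ z₂ w₂ z₃ w₃ j := by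
  have expand : ((C z₁ * X 0 - C w₁ * X 1) *
      ((C z₂ * X 0 - C w₂ * X 1) * (C z₃ * X 0 - C w₃ * X 1)) : MvPolynomial (Fin 2) ℂ) =
      ∑ k : Fin 4, monomial (Finsupp.single 0 (k : ℕ) + Finsupp.single 1 (3 - (k : ℕ)))
        (cubicCoeff z₁ w₁ z₂ w₂ z₃ w₃ k) := by
    have hm : ∀ (a b : ℕ) (c : ℂ), (monomial (Finsupp.single 0 a + Finsupp.single 1 b) c :
        MvPolynomial (Fin 2) ℂ) = C c * (X 0 ^ a * X 1 ^ b) := by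
      intro a b c
      rw [X_pow_eq_monomial, X_pow_eq_monomial, monomial_mul, C_mul_monomial]
      simp
    simp only [hm, Fin.sum_univ_four, cubicCoeff]
    simp
    ring
  rw [expand, coeff_sum, Finset.sum_eq_single j]
  · simp
  · intro k _ hk
    rw [coeff_monomial, if_neg]
    intro h
    apply hk
    have := DFunLike.congr_fun h 0
    simp at this
    exact Fin.ext this
  · simp

theorem atiyahMatrix_four (z w : Fin 4 → Fin 4 → ℂ) :
    atiyahMatrix z w = Matrix.of
      ![cubicCoeff (z 0 1) (w 0 1) (z 0 2) (w 0 2) (z 0 3) (w 0 3),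
        cubicCoeff (z 1 0) (w 1 0) (z 1 2) (w 1 2) (z 1 3) (w 1 3),
        cubicCoeff (z 2 0) (w 2 0) (z 2 1) (w 2 1) (z 2 3) (w 2 3),
        cubicCoeff (z 3 0) (w 3 0) (z 3 1) (w 3 1) (z 3 2) (w 3 2)] := by
  have e0 : (Finset.univ.erase 0 : Finset (Fin 4)) = {1, 2, 3} := by decide
  have e1 : (Finset.univ.erase 1 : Finset (Fin 4)) = {0, 2, 3} := by decide
  have e2 : (Finset.univ.erase 2 : Finset (Fin 4)) = {0, 1, 3} := by decide
  have e3 : (Finset.univ.erase 3 : Finset (Fin 4)) = {0, 1, 2} := by decide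
  ext i j
  fin_cases i <;>
    simp [atiyahMatrix, atiyahPoly, e0, e1, e2, e3, coeff_mul_linear_eq_cubicCoeff,
      -Finsupp.single_tsub]

/-- The action of a matrix of size two on binary cubics. -/
noncomputable def cubicAction (a b c d : ℂ) : Matrix (Fin 4) (Fin 4) ℂ :=
  !![d ^ 3, -3 * b * d ^ 2, 3 * b ^ 2 * d, -b ^ 3;
    -c * d ^ 2, a * d ^ 2 + 2 * b * c * d, -2 * a * b * d - c * b ^ 2, a * b ^ 2;
    c ^ 2 * d, -2 * a * c * d - b * c ^ 2, a ^ 2 * d + 2 * a * b * c, -a ^ 2 * b;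
    -c ^ 3, 3 * a * c ^ 2, -3 * a ^ 2 * c, a ^ 3]

/-- On the third symmetric power the eigenvalue products `λ³, λ²μ, λμ², μ³` multiply to `(λμ)⁶`. -/
theorem det_cubicAction (a b c d : ℂ) : (cubicAction a b c d).det = (a * d - b * c) ^ 6 := by
  rw [cubicAction, Matrix.det_succ_row_zero]
  simp [Fin.sum_univ_succ, Matrix.det_fin_three, Fin.succAbove]
  ring

theorem cubicCoeff_vecMul (a b c d z₁ w₁ z₂ w₂ z₃ w₃ : ℂ) (j : Fin 4) :
    cubicCoeff (a * z₁ + b * w₁) (c * z₁ + d * w₁) (a * z₂ + b * w₂) (c * z₂ + d * w₂)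
      (a * z₃ + b * w₃) (c * z₃ + d * w₃) j =
    ∑ k, cubicCoeff z₁ w₁ z₂ w₂ z₃ w₃ k * cubicAction a b c d k j := by
  fin_cases j <;> simp [cubicCoeff, cubicAction, Fin.sum_univ_four] <;> ring

theorem det_atiyahMatrix_linear (a b c d : ℂ) (z w : Fin 4 → Fin 4 → ℂ) :
    (atiyahMatrix (fun i j => a * z i j + b * w i j) fun i j => c * z i j + d * w i j).det =
      (a * d - b * c) ^ 6 * (atiyahMatrix z w).det := by
  rw [← det_cubicAction, mul_comm, ← Matrix.det_mul, atiyahMatrix_four, atiyahMatrix_four]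
  congr 1
  ext i j
  rw [Matrix.mul_apply]
  fin_cases i <;> simp only [Matrix.of_apply] <;> exact cubicCoeff_vecMul a b c d _ _ _ _ _ _ j

theorem atiyahMatrix_congr {n : ℕ} {z w z' w' : Fin n → Fin n → ℂ}
    (hz : ∀ i j, i ≠ j → z i j = z' i j) (hw : ∀ i j, i ≠ j → w i j = w' i j) :
    atiyahMatrix z w = atiyahMatrix z' w' := by
  have hp : ∀ i, atiyahPoly z w i = atiyahPoly z' w' i := fun i =>
    Finset.prod_congr rfl fun k hk => by
      rw [hz i k (Finset.ne_of_mem_erase hk).symm, hw i k (Finset.ne_of_mem_erase hk).symm]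
  ext i j
  simp only [atiyahMatrix, Matrix.of_apply, hp]

theorem atiyahMatrix_mul {n : ℕ} (v z w : Fin n → Fin n → ℂ) :
    atiyahMatrix (fun i j => v i j * z i j) (fun i j => v i j * w i j) =
      Matrix.of fun i j => (∏ k ∈ Finset.univ.erase i, v i k) * atiyahMatrix z w i j := by
  have hp : ∀ i, atiyahPoly (fun i j => v i j * z i j) (fun i j => v i j * w i j) i =
      MvPolynomial.C (∏ k ∈ Finset.univ.erase i, v i k) * atiyahPoly z w i := by
    intro i
    rw [atiyahPoly, atiyahPoly, map_prod, ← Finset.prod_mul_distrib]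
    refine Finset.prod_congr rfl fun k hk => ?_
    rw [map_mul, map_mul]
    ring
  ext i j
  simp only [atiyahMatrix, Matrix.of_apply, hp, MvPolynomial.coeff_C_mul]

/-- Row `i` is scaled by three factors of norm `r`, one for each other point; the four rows together
give exponent twelve. -/
theorem norm_det_atiyahMatrix_mul (v z w : Fin 4 → Fin 4 → ℂ) (r : ℝ)
    (hv : ∀ i j, i ≠ j → ‖v i j‖ = r) :
    ‖(atiyahMatrix (fun i j => v i j * z i j) (fun i j => v i j * w i j)).det‖ =
      r ^ 12 * ‖(atiyahMatrix z w).det‖ := by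
  have h : ∀ i : Fin 4, ∏ k ∈ Finset.univ.erase i, ‖v i k‖ = r ^ 3 := by
    intro i
    rw [Finset.prod_congr rfl fun k hk => hv i k (Finset.ne_of_mem_erase hk).symm]
    simp
  rw [atiyahMatrix_mul, Matrix.det_mul_column, norm_mul]
  simp only [norm_prod, h]
  simp
  left
  ring

theorem atiyahMatrix_comp_perm {n : ℕ} (σ : Equiv.Perm (Fin n)) (z w : Fin n → Fin n → ℂ) :
    atiyahMatrix (fun i j => z (σ i) (σ j)) (fun i j => w (σ i) (σ j)) =
      (atiyahMatrix z w).submatrix σ id := by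
  have hp : ∀ i, atiyahPoly (fun i j => z (σ i) (σ j)) (fun i j => w (σ i) (σ j)) i =
      atiyahPoly z w (σ i) := by
    intro i
    refine Finset.prod_bij (fun k _ => σ k) ?_ ?_ ?_ ?_
    · intro k hk
      simpa using hk
    · intro a _ b _ h
      exact σ.injective h
    · intro b hb
      exact ⟨σ.symm b, by simpa [Equiv.symm_apply_eq] using hb, by simp⟩
    · intro k _
      rfl
  ext i j
  simp only [atiyahMatrix, Matrix.of_apply, hp, Matrix.submatrix_apply, id]

theorem norm_det_atiyahMatrix_comp_perm {n : ℕ} (σ : Equiv.Perm (Fin n))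
    (z w : Fin n → Fin n → ℂ) :
    ‖(atiyahMatrix (fun i j => z (σ i) (σ j)) (fun i j => w (σ i) (σ j))).det‖ =
      ‖(atiyahMatrix z w).det‖ := by
  rw [atiyahMatrix_comp_perm, Matrix.det_permute]
  rcases Int.units_eq_one_or (Equiv.Perm.sign σ) with h | h <;> simp [h]

-- The bridge to trigonometry. Oppositeness of `u i j` and `u j i` leaves six directions. The first
-- diagonal is taken as reference direction and the second makes angle `φ` with it. The prefactor is
-- minus the product of the six directions, hence unimodular.
open Complex in
theorem det_atiyahMatrix_of_angles (u : Fin 4 → Fin 4 → ℂ) (hu : ∀ i j, u j i = -u i j)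
    (φ a₁ a₂ c₁ c₂ : ℝ) (h02 : u 0 2 = 1) (h13 : u 1 3 = exp (φ * I)) (h03 : u 0 3 = exp (a₂ * I))
    (h12 : u 1 2 = exp (c₂ * I)) (h01 : u 0 1 = exp (-(a₁ * I))) (h23 : u 3 2 = exp (-(c₁ * I))) :
    (atiyahMatrix u fun _ _ => 1).det =
      -(exp (φ * I) * exp (a₂ * I) * exp (c₂ * I) * exp (-(a₁ * I)) * exp (-(c₁ * I))) *
        ((64 + quadExcess a₁ a₂ (φ - c₂) (Real.pi - φ - a₁) c₁ c₂ (φ - a₂) (Real.pi - φ - c₁) : ℝ) :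
          ℂ) := by
  have hcos : ∀ t : ℝ, ((Real.cos t : ℝ) : ℂ) = (exp (t * I) + (exp (t * I))⁻¹) / 2 := by
    intro t
    rw [ofReal_cos, Complex.cos, neg_mul, exp_neg]
  rw [atiyahMatrix_four, hu 0 1, hu 0 2, hu 1 2, hu 0 3, hu 1 3, hu 3 2,
    h02, h13, h03, h12, h01, h23]
  simp only [quadExcess, sumCosSq, sinHalfProd, ofReal_add, ofReal_mul, ofReal_sub, ofReal_one,
    ofReal_ofNat, hcos, add_mul, sub_mul, exp_add, exp_sub, exp_pi_mul_I, exp_neg]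
  have hF := exp_ne_zero (φ * I)
  have hP := exp_ne_zero (a₂ * I)
  have hQ := exp_ne_zero (c₂ * I)
  have hS := exp_ne_zero (a₁ * I)
  have hT := exp_ne_zero (c₁ * I)
  generalize exp (φ * I) = F at *
  generalize exp (a₂ * I) = P at *
  generalize exp (c₂ * I) = Q at *
  generalize exp (a₁ * I) = S at *
  generalize exp (c₁ * I) = T at *
  -- What remains is a rational identity in five independent nonzero variables.
  rw [Matrix.det_succ_row_zero]
  have s1 : Fin.succAbove (1 : Fin 4) (2 : Fin 3) = 3 := rfl
  have s2 : Fin.succAbove (2 : Fin 4) (1 : Fin 3) = 1 := rfl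
  have s3 : Fin.succAbove (2 : Fin 4) (2 : Fin 3) = 3 := rfl
  have s4 : Fin.succAbove (3 : Fin 4) (1 : Fin 3) = 1 := rfl
  have s5 : Fin.succAbove (3 : Fin 4) (2 : Fin 3) = 2 := rfl
  simp only [cubicCoeff, Fin.sum_univ_succ, Matrix.det_fin_three]
  simp [s1, s2, s3, s4, s5]
  field_simp
  ring

/-! ### Angles of a normalised quadrilateral. -/

/-- The direction from `p i` to `p j`. -/
noncomputable def planarDir {n : ℕ} (p : Fin n → ℂ) (i j : Fin n) : ℂ := (p j - p i) / ‖p j - p i‖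

theorem planarDir_swap {n : ℕ} (p : Fin n → ℂ) (i j : Fin n) :
    planarDir p j i = -planarDir p i j := by
  rw [planarDir, planarDir, norm_sub_rev, ← neg_sub (p j), neg_div]

open Complex in
theorem exists_angle {a d φ : ℝ} (ha : 0 < a) (hd : 0 < d) (h0 : 0 < φ) (hφ : φ < Real.pi) :
    ∃ θ : ℝ, 0 ≤ θ ∧ θ ≤ φ ∧
      (a + d * exp (φ * I) : ℂ) / ‖(a + d * exp (φ * I) : ℂ)‖ = exp (θ * I) := by
  set ζ : ℂ := a + d * exp (φ * I) with hζ
  have him : ζ.im = d * Real.sin φ := by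
    simp [hζ, exp_ofReal_mul_I_re, exp_ofReal_mul_I_im]
  have hre : ζ.re = a + d * Real.cos φ := by
    simp [hζ, exp_ofReal_mul_I_re, exp_ofReal_mul_I_im]
  have hs := Real.sin_pos_of_pos_of_lt_pi h0 hφ
  have him0 : 0 < ζ.im := him ▸ mul_pos hd hs
  have hne : ζ ≠ 0 := by
    intro h; rw [h] at him0; simp at him0
  have hn : 0 < ‖ζ‖ := norm_pos_iff.2 hne
  have hnC : (‖ζ‖ : ℂ) ≠ 0 := by exact_mod_cast hn.ne'
  refine ⟨arg ζ, arg_nonneg_iff.2 him0.le, ?_, ?_⟩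
  · have hsub : 0 < Real.sin (φ - arg ζ) := by
      rw [Real.sin_sub, sin_arg, cos_arg hne, him, hre]
      have : Real.sin φ * ((a + d * Real.cos φ) / ‖ζ‖) - Real.cos φ * (d * Real.sin φ / ‖ζ‖) =
          a * Real.sin φ / ‖ζ‖ := by ring
      rw [this]
      positivity
    by_contra hlt
    have := Real.sin_nonpos_of_nonpos_of_neg_pi_le (x := φ - arg ζ) (by linarith)
      (by linarith [arg_le_pi ζ])
    linarith
  · rw [div_eq_iff hnC, mul_comm]
    exact (norm_mul_exp_arg_mul_I ζ).symm

open Complex in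
theorem exists_angle_neg {a d φ : ℝ} (ha : 0 < a) (hd : 0 < d) (h0 : 0 < φ) (hφ : φ < Real.pi) :
    ∃ θ : ℝ, 0 ≤ θ ∧ θ ≤ Real.pi - φ ∧
      (a - d * exp (φ * I) : ℂ) / ‖(a - d * exp (φ * I) : ℂ)‖ = exp (-(θ * I)) := by
  obtain ⟨θ, h1, h2, h3⟩ := exists_angle ha hd (φ := Real.pi - φ) (by linarith) (by linarith)
  refine ⟨θ, h1, h2, ?_⟩
  -- Reflection in the real axis turns `-exp (φ * I)` into the direction of angle `π - φ`.
  have e : (a - d * exp (φ * I) : ℂ) = conj (a + d * exp ((Real.pi - φ : ℝ) * I) : ℂ) := by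
    rw [map_add, map_mul, conj_ofReal, conj_ofReal, ← exp_conj, map_mul, conj_ofReal, conj_I]
    have : ((Real.pi - φ : ℝ) : ℂ) * -I = φ * I - Real.pi * I := by push_cast; ring
    rw [this, exp_sub, exp_pi_mul_I]
    ring
  rw [e, norm_conj]
  have := congrArg conj h3
  rw [map_div₀, conj_ofReal, ← exp_conj, map_mul, conj_ofReal, conj_I, mul_neg] at this
  exact this

-- The diagonals cross at `0`, the first being the real segment from `-s` to `1 - s`. Each side is a
-- positive combination of two half-diagonals, so its angle with the real axis is bounded by `φ` or
-- `π - φ`; this makes all eight angles nonnegative.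
open Complex in
theorem le_norm_det_of_diagonals {s t : ℝ} {g : ℂ} (hs0 : 0 < s) (hs1 : s < 1) (ht0 : 0 < t)
    (ht1 : t < 1) (hg : 0 < g.im) {p : Fin 4 → ℂ} (h0 : p 0 = -s) (h1 : p 1 = -(t * g))
    (h2 : p 2 = 1 - s) (h3 : p 3 = (1 - t) * g) :
    64 ≤ ‖(atiyahMatrix (planarDir p) fun _ _ => 1).det‖ := by
  have hgne : g ≠ 0 := by
    intro h; rw [h] at hg; simp at hg
  have hr : 0 < ‖g‖ := norm_pos_iff.2 hgne
  set φ := arg g with hφ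
  have hpol : g = ‖g‖ * exp (φ * I) := (norm_mul_exp_arg_mul_I g).symm
  have hφ0 : 0 < φ := by
    rcases (arg_nonneg_iff.2 hg.le).lt_or_eq with h | h
    · exact h
    · have := (arg_eq_zero_iff.1 h.symm).2
      linarith
  have hφ1 : φ < Real.pi := lt_of_le_of_ne (arg_le_pi g) fun h => by
    have := (arg_eq_pi_iff.1 h).2
    linarith
  set r := ‖g‖
  have hrC : (r : ℂ) ≠ 0 := by exact_mod_cast hr.ne'
  obtain ⟨a₂, ha0, ha1, ha⟩ := exists_angle hs0 (mul_pos (sub_pos.2 ht1) hr) hφ0 hφ1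
  obtain ⟨c₂, hc0, hc1, hc⟩ := exists_angle (sub_pos.2 hs1) (mul_pos ht0 hr) hφ0 hφ1
  obtain ⟨a₁, hA0, hA1, hA⟩ := exists_angle_neg hs0 (mul_pos ht0 hr) hφ0 hφ1
  obtain ⟨c₁, hC0, hC1, hC⟩ :=
    exists_angle_neg (sub_pos.2 hs1) (mul_pos (sub_pos.2 ht1) hr) hφ0 hφ1
  have key := det_atiyahMatrix_of_angles (planarDir p) (planarDir_swap p) φ a₁ a₂ c₁ c₂
    (by simp [planarDir, h0, h2])
    (by
      have : p 3 - p 1 = g := by rw [h1, h3]; ring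
      rw [planarDir, this, div_eq_iff hrC, mul_comm]
      exact hpol)
    (by
      rw [planarDir, ← ha]
      have : p 3 - p 0 = s + ((1 - t) * r : ℝ) * exp (φ * I) := by
        rw [h0, h3]; nth_rewrite 1 [hpol]; push_cast; ring
      rw [this])
    (by
      rw [planarDir, ← hc]
      have : p 2 - p 1 = (1 - s : ℝ) + (t * r : ℝ) * exp (φ * I) := by
        rw [h1, h2]; nth_rewrite 1 [hpol]; push_cast; ring
      rw [this])
    (by
      rw [planarDir, ← hA]
      have : p 1 - p 0 = s - (t * r : ℝ) * exp (φ * I) := by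
        rw [h0, h1]; nth_rewrite 1 [hpol]; push_cast; ring
      rw [this])
    (by
      rw [planarDir, ← hC]
      have : p 2 - p 3 = (1 - s : ℝ) - ((1 - t) * r : ℝ) * exp (φ * I) := by
        rw [h2, h3]; nth_rewrite 1 [hpol]; push_cast; ring
      rw [this])
  have hQ := quadExcess_nonneg hA0 ha0 (b₁ := φ - c₂) (b₂ := Real.pi - φ - a₁) (by linarith)
    (by linarith) hC0 hc0 (d₁ := φ - a₂) (d₂ := Real.pi - φ - c₁) (by linarith) (by linarith)
    (by ring) (by ring) (by ring)
  rw [key]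
  have hn : ∀ x : ℝ, ‖exp (-(x * I))‖ = 1 := fun x => by
    rw [← neg_mul, ← ofReal_neg, norm_exp_ofReal_mul_I]
  simp only [norm_mul, norm_neg, norm_exp_ofReal_mul_I, hn, one_mul, norm_real, Real.norm_eq_abs]
  rw [abs_of_nonneg (by linarith)]
  linarith

/-! ### Convex quadrilaterals in the complex plane. -/

theorem norm_det_planarDir_similarity {p p' : Fin 4 → ℂ} {E o : ℂ} (hE : E ≠ 0)
    (h : ∀ i, p i = o + E * p' i) :
    ‖(atiyahMatrix (planarDir p) fun _ _ => 1).det‖ =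
      ‖(atiyahMatrix (planarDir p') fun _ _ => 1).det‖ := by
  have hE' : (‖E‖ : ℂ) ≠ 0 := by exact_mod_cast norm_ne_zero_iff.2 hE
  have hdir : ∀ i j, planarDir p i j = E / ‖E‖ * planarDir p' i j := by
    intro i j
    have : p j - p i = E * (p' j - p' i) := by rw [h, h]; ring
    rw [planarDir, this, norm_mul, Complex.ofReal_mul, mul_div_mul_comm, planarDir]
  have := det_atiyahMatrix_linear (E / ‖E‖) 0 0 1 (planarDir p') fun _ _ => 1
  simp only [zero_mul, add_zero, zero_add, mul_one, sub_zero] at this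
  rw [show planarDir p = fun i j => E / ‖E‖ * planarDir p' i j from funext₂ hdir, this, norm_mul,
    norm_pow, norm_div, Complex.norm_real, norm_norm, div_self (norm_ne_zero_iff.2 hE)]
  simp

theorem ConvexIndependent.notMem_segment {ι : Type*} {p : ι → ℂ} (hp : ConvexIndependent ℝ p)
    {i j k : ι} (hij : i ≠ j) (hik : i ≠ k) : p i ∉ segment ℝ (p j) (p k) := by
  intro h
  have := hp {j, k} i (by rwa [Set.image_pair, convexHull_pair])
  rcases this with h | h
  · exact hij h
  · exact hik h

theorem exists_mem_Ioo_of_mem_segment {a b o : ℂ} (h : o ∈ segment ℝ a b) (ha : o ≠ a)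
    (hb : o ≠ b) : ∃ s : ℝ, 0 < s ∧ s < 1 ∧ a = o - s * (b - a) := by
  obtain ⟨u, v, hu, hv, huv, rfl⟩ := h
  refine ⟨v, hv.lt_of_ne' ?_, lt_of_le_of_ne (by linarith) ?_, ?_⟩
  · rintro rfl
    exact ha (by simp [show u = 1 by linarith])
  · rintro rfl
    exact hb (by simp [show u = 0 by linarith])
  · have : u = 1 - v := by linarith
    subst this
    simp
    ring

/-- Parallel crossing diagonals would make all four points collinear, and then some vertex would lie
on the other diagonal. -/
theorem ConvexIndependent.im_div_ne_zero {p : Fin 4 → ℂ} (hp : ConvexIndependent ℝ p) {o : ℂ}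
    {s t : ℝ} (hs0 : 0 < s) (hs1 : s < 1) (ht0 : 0 < t) (ht1 : t < 1) (hE : p 2 - p 0 ≠ 0)
    (h02 : p 0 = o - s * (p 2 - p 0)) (h13 : p 1 = o - t * (p 3 - p 1)) :
    ((p 3 - p 1) / (p 2 - p 0)).im ≠ 0 := by
  intro him
  set g := ((p 3 - p 1) / (p 2 - p 0)).re with hg
  have hgC : p 3 - p 1 = g * (p 2 - p 0) := by
    rw [← div_eq_iff hE]
    exact Complex.ext (by simp [hg]) (by simpa using him)
  have seg : ∀ {a b c : ℂ} {l : ℝ}, 0 ≤ l → l ≤ 1 → c = a + l * (b - a) → c ∈ segment ℝ a b := by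
    rintro a b c l h0 h1 rfl
    exact ⟨1 - l, l, by linarith, h0, by ring, by simp; ring⟩
  have h3 : p 3 = p 1 + g * (p 2 - p 0) := by rw [← hgC]; ring
  -- On the common line, with origin `o` and unit `p 2 - p 0`, the points `p 0, p 1, p 2, p 3` sit
  -- at `-s, -t g, 1 - s, (1 - t) g`. Either `p 1` and `p 3` are both at least `-s`, and the one on
  -- the nonpositive side of `o` lies between `p 0` and `p 2`, or `p 0` lies between `p 1` and `p
  -- 3`.
  rcases le_or_gt (t * g) s with h1 | h1
  · rcases le_or_gt (-((1 - t) * g)) s with h2 | h2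
    · rcases le_or_gt 0 g with h | h
      · refine hp.notMem_segment (i := 1) (j := 0) (k := 2) (by decide) (by decide)
          (seg (l := s - t * g) (by linarith) (by nlinarith) ?_)
        push_cast
        linear_combination h13 - h02 - t * hgC
      · refine hp.notMem_segment (i := 3) (j := 0) (k := 2) (by decide) (by decide)
          (seg (l := s + (1 - t) * g) (by linarith) (by nlinarith) ?_)
        push_cast
        linear_combination h13 - h02 + (1 - t) * hgC
    · have hg0 : g < 0 := by nlinarith
      refine hp.notMem_segment (i := 0) (j := 1) (k := 3) (by decide) (by decide)
        (seg (l := t + s / (-g)) (by have := div_pos hs0 (neg_pos.2 hg0); linarith) ?_ ?_)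
      · have : s / (-g) ≤ 1 - t := by
          rw [div_le_iff₀ (by linarith)]; linarith
        linarith
      · have hgne : (g : ℂ) ≠ 0 := by exact_mod_cast hg0.ne
        have : ((t + s / (-g) : ℝ) : ℂ) * (p 3 - p 1) = t * (p 3 - p 1) - s * (p 2 - p 0) := by
          rw [hgC]; push_cast; field_simp; ring
        rw [this]
        linear_combination h02 - h13
  · have hg0 : 0 < g := by
      by_contra h
      nlinarith
    refine hp.notMem_segment (i := 0) (j := 1) (k := 3) (by decide) (by decide)
      (seg (l := t - s / g) ?_ (by have := div_pos hs0 hg0; linarith) ?_)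
    · have : s / g ≤ t := by
        rw [div_le_iff₀ hg0]; exact h1.le
      linarith
    · have hgne : (g : ℂ) ≠ 0 := by exact_mod_cast hg0.ne'
      have : ((t - s / g : ℝ) : ℂ) * (p 3 - p 1) = t * (p 3 - p 1) - s * (p 2 - p 0) := by
        rw [hgC]; push_cast; field_simp
      rw [this]
      linear_combination h02 - h13

theorem le_norm_det_of_crossing {p : Fin 4 → ℂ} (hp : ConvexIndependent ℝ p) {o : ℂ}
    (h02 : o ∈ segment ℝ (p 0) (p 2)) (h13 : o ∈ segment ℝ (p 1) (p 3)) :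
    64 ≤ ‖(atiyahMatrix (planarDir p) fun _ _ => 1).det‖ := by
  have ne : ∀ {i j k : Fin 4}, i ≠ j → i ≠ k → o ∈ segment ℝ (p j) (p k) → o ≠ p i :=
    fun hij hik h e => hp.notMem_segment hij hik (e ▸ h)
  obtain ⟨s, hs0, hs1, hs⟩ := exists_mem_Ioo_of_mem_segment h02
    (ne (by decide) (by decide) h13) (ne (by decide) (by decide) h13)
  obtain ⟨t, ht0, ht1, ht⟩ := exists_mem_Ioo_of_mem_segment h13
    (ne (by decide) (by decide) h02) (ne (by decide) (by decide) h02)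
  have hE : p 2 - p 0 ≠ 0 := sub_ne_zero.2 fun h => absurd (hp.injective h) (by decide)
  have him := hp.im_div_ne_zero hs0 hs1 ht0 ht1 hE hs ht
  set g := (p 3 - p 1) / (p 2 - p 0) with hg
  have hgE : p 3 - p 1 = g * (p 2 - p 0) := by rw [hg]; field_simp
  -- The normal form needs `0 < g.im`. Exchanging the vertices `1` and `3` reverses orientation,
  -- replacing `g` by `-g` and `t` by `1 - t`.
  rcases him.lt_or_gt with him | him
  · have hsw : (fun i j => planarDir (p ∘ Equiv.swap 1 3) i j) =
        fun i j => planarDir p (Equiv.swap 1 3 i) (Equiv.swap 1 3 j) := rfl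
    have h1 := norm_det_atiyahMatrix_comp_perm (Equiv.swap 1 3) (planarDir p) fun _ _ => 1
    rw [← hsw] at h1
    rw [← h1, norm_det_planarDir_similarity (p := p ∘ Equiv.swap 1 3)
      (p' := ![-s, -((1 - t : ℝ) * -g), 1 - s, (1 - (1 - t : ℝ)) * -g]) (o := o) hE]
    · exact le_norm_det_of_diagonals hs0 hs1 (sub_pos.2 ht1) (by linarith) (by simpa using him)
        rfl rfl rfl rfl
    · intro i
      fin_cases i
      · have : (Equiv.swap 1 3 : Equiv.Perm (Fin 4)) 0 = 0 := by decide
        simp [this]; linear_combination hs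
      · simp; linear_combination ht + (1 - t) * hgE
      · have : (Equiv.swap 1 3 : Equiv.Perm (Fin 4)) 2 = 2 := by decide
        simp [this]; linear_combination hs
      · simp; linear_combination ht - t * hgE
  · rw [norm_det_planarDir_similarity (p := p)
      (p' := ![-s, -(t * g), 1 - s, (1 - t) * g]) (o := o) hE]
    · exact le_norm_det_of_diagonals hs0 hs1 ht0 ht1 him rfl rfl rfl rfl
    · intro i
      fin_cases i <;> simp
      · linear_combination hs
      · linear_combination ht - t * hgE
      · linear_combination hs
      · linear_combination ht + (1 - t) * hgE

theorem ConvexIndependent.exists_crossing {p : Fin 4 → ℂ} (hp : ConvexIndependent ℝ p) :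
    ∃ (σ : Equiv.Perm (Fin 4)) (o : ℂ),
      o ∈ segment ℝ (p (σ 0)) (p (σ 2)) ∧ o ∈ segment ℝ (p (σ 1)) (p (σ 3)) := by
  classical
  have hdep : ¬AffineIndependent ℝ p := by
    intro h
    have h1 := h.card_le_finrank_succ
    have h2 := Submodule.finrank_le (vectorSpan ℝ (Set.range p))
    rw [Complex.finrank_real_complex] at h2
    simp at h1
    omega
  -- In a Radon partition neither part is empty, as the hulls meet, and neither is a singleton, by
  -- convex independence. So it is two against two, and the pairs are the diagonals.
  obtain ⟨J, o, h1, h2⟩ := Convex.radon_partition hdep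
  have hsplit : ∀ S : Finset (Fin 4), S = ∅ ∨ Sᶜ = ∅ ∨ (∃ i, S = {i}) ∨ (∃ i, Sᶜ = {i}) ∨
      ∃ σ : Equiv.Perm (Fin 4), S = {σ 0, σ 2} ∧ Sᶜ = {σ 1, σ 3} := by decide
  have hJ : (J.toFinset : Set (Fin 4)) = J := by simp
  have hJc : ((J.toFinset)ᶜ : Finset (Fin 4)) = (Jᶜ : Set (Fin 4)) := by simp
  rcases hsplit J.toFinset with h | h | ⟨i, h⟩ | ⟨i, h⟩ | ⟨σ, h, h'⟩
  · rw [← hJ, h] at h1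
    simp at h1
  · rw [← hJc, h] at h2
    simp at h2
  · rw [← hJ, h] at h1
    simp at h1
    have := hp _ i (h1 ▸ h2)
    rw [← hJc, h] at this
    simp at this
  · rw [← hJc, h] at h2
    simp at h2
    have := hp _ i (h2 ▸ h1)
    rw [← hJ, ← compl_compl J.toFinset, h] at this
    simp at this
  · rw [← hJ, h] at h1
    rw [← hJc, h'] at h2
    refine ⟨σ, o, ?_, ?_⟩
    · simpa [Set.image_pair, convexHull_pair] using h1
    · simpa [Set.image_pair, convexHull_pair] using h2

theorem ConvexIndependent.le_norm_det {p : Fin 4 → ℂ} (hp : ConvexIndependent ℝ p) :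
    64 ≤ ‖(atiyahMatrix (planarDir p) fun _ _ => 1).det‖ := by
  obtain ⟨σ, o, h1, h2⟩ := hp.exists_crossing
  rw [← norm_det_atiyahMatrix_comp_perm σ]
  exact le_norm_det_of_crossing (p := p ∘ σ) (hp.comp_embedding σ.toEmbedding) h1 h2

/-! ### Spinors and the passage from space to the plane. -/

theorem conj_stereoNum (p q : E3) :
    conj (stereoNum p q) =
      ((q 0 - p 0 : ℝ) : ℂ) - ((q 1 - p 1 : ℝ) : ℂ) * Complex.I := by
  simp [stereoNum]
  ring

/-- With `ψ = (z, w)` and `v` the difference of the two points, these are entries of `2 r ψ ψ* = r +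
v · σ`, for suitably signed Pauli matrices `σ`. The stereographic condition thus takes a form free
of phases and of the case of a vanishing denominator. -/
theorem IsAtiyahChoice.spinor_of_lt {n : ℕ} {x : Fin n → E3} {z w : Fin n → Fin n → ℂ}
    (h : IsAtiyahChoice x z w) {i j : Fin n} (hij : i < j) {r : ℝ}
    (hr : √(∑ k, (x j k - x i k) ^ 2) = r) :
    2 * (r : ℂ) * (z i j * conj (z i j)) = r + (x j 2 - x i 2 : ℝ) ∧
      2 * (r : ℂ) * (w i j * conj (w i j)) = r - (x j 2 - x i 2 : ℝ) ∧
      2 * (r : ℂ) * (z i j * conj (w i j)) = stereoNum (x i) (x j) := by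
  have hr2 : (x j 0 - x i 0) ^ 2 + (x j 1 - x i 1) ^ 2 + (x j 2 - x i 2) ^ 2 = r ^ 2 := by
    rw [← hr, Real.sq_sqrt (Finset.sum_nonneg fun _ _ => sq_nonneg _), Fin.sum_univ_three]
  have hden : stereoDen (x i) (x j) = r - (x j 2 - x i 2) := by rw [stereoDen, hr]
  have hn : z i j * conj (z i j) + w i j * conj (w i j) = 1 := by
    rw [Complex.mul_conj', Complex.mul_conj']
    exact_mod_cast h.norm_eq i j hij
  by_cases hd : stereoDen (x i) (x j) = 0
  · have hw := h.of_den_eq_zero i j hij hd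
    have hv2 : x j 2 - x i 2 = r := by linarith
    have hv0 : x j 0 - x i 0 = 0 := by
      rw [hv2] at hr2
      exact pow_eq_zero_iff two_ne_zero |>.1
        (by nlinarith [sq_nonneg (x j 1 - x i 1), sq_nonneg (x j 0 - x i 0)])
    have hv1 : x j 1 - x i 1 = 0 := by
      rw [hv2] at hr2
      exact pow_eq_zero_iff two_ne_zero |>.1
        (by nlinarith [sq_nonneg (x j 1 - x i 1), sq_nonneg (x j 0 - x i 0)])
    rw [hw] at hn ⊢
    simp only [add_zero, map_zero, mul_zero] at hn ⊢
    rw [hn, hv2, stereoNum, hv0, hv1]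
    refine ⟨by ring, by ring, by simp⟩
  · obtain ⟨hw, hq⟩ := h.of_den_ne_zero i j hij hd
    have hdC : (stereoDen (x i) (x j) : ℂ) ≠ 0 := by exact_mod_cast hd
    have hz : z i j = w i j * stereoNum (x i) (x j) / stereoDen (x i) (x j) := by
      rw [div_eq_iff hw] at hq
      rw [hq]; ring
    have hnum : stereoNum (x i) (x j) * conj (stereoNum (x i) (x j)) =
        (r + (x j 2 - x i 2 : ℝ)) * (stereoDen (x i) (x j) : ℂ) := by
      have : (((x j 0 - x i 0) ^ 2 + (x j 1 - x i 1) ^ 2 + (x j 2 - x i 2) ^ 2 : ℝ) : ℂ) =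
        ((r ^ 2 : ℝ) : ℂ) := by rw [hr2]
      rw [conj_stereoNum, stereoNum, hden]
      push_cast at this ⊢
      linear_combination this - ((x j 1 : ℂ) - x i 1) ^ 2 * Complex.I_sq
    have hw2 : 2 * (r : ℂ) * (w i j * conj (w i j)) = stereoDen (x i) (x j) := by
      rw [hz] at hn
      simp only [map_div₀, map_mul, Complex.conj_ofReal] at hn
      have e : w i j * stereoNum (x i) (x j) / stereoDen (x i) (x j) *
          (conj (w i j) * conj (stereoNum (x i) (x j)) / stereoDen (x i) (x j)) =
          w i j * conj (w i j) * (r + (x j 2 - x i 2 : ℝ)) / stereoDen (x i) (x j) := by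
        field_simp
        linear_combination conj (w i j) * hnum
      rw [e] at hn
      field_simp at hn
      have hdenC : (stereoDen (x i) (x j) : ℂ) = r - (x j 2 - x i 2 : ℝ) := by
        rw [hden]; push_cast; ring
      linear_combination hn - w i j * conj (w i j) * hdenC
    have hdenC : (stereoDen (x i) (x j) : ℂ) = r - (x j 2 - x i 2 : ℝ) := by
      rw [hden]; push_cast; ring
    refine ⟨?_, ?_, ?_⟩
    · linear_combination 2 * (r : ℂ) * hn - hw2 - hdenC
    · rw [hw2, hdenC]
    · rw [hz]
      field_simp
      linear_combination stereoNum (x i) (x j) * hw2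

theorem IsAtiyahChoice.spinor {n : ℕ} {x : Fin n → E3} {z w : Fin n → Fin n → ℂ}
    (h : IsAtiyahChoice x z w) {i j : Fin n} (hij : i ≠ j) {r : ℝ}
    (hr : √(∑ k, (x j k - x i k) ^ 2) = r) :
    2 * (r : ℂ) * (z i j * conj (z i j)) = r + (x j 2 - x i 2 : ℝ) ∧
      2 * (r : ℂ) * (w i j * conj (w i j)) = r - (x j 2 - x i 2 : ℝ) ∧
      2 * (r : ℂ) * (z i j * conj (w i j)) = stereoNum (x i) (x j) := by
  rcases lt_or_gt_of_ne hij with hlt | hlt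
  · exact h.spinor_of_lt hlt hr
  · have hr' : √(∑ k, (x i k - x j k) ^ 2) = r := by
      rw [← hr]
      congr 1
      exact Finset.sum_congr rfl fun k _ => by ring
    obtain ⟨h1, h2, h3⟩ := h.spinor_of_lt hlt hr'
    rw [h.z_swap j i hlt, h.w_swap j i hlt]
    simp only [map_neg, Complex.conj_conj]
    push_cast at h1 h2 ⊢
    refine ⟨by linear_combination h2, by linear_combination h1, ?_⟩
    have : stereoNum (x i) (x j) = -stereoNum (x j) (x i) := by
      simp [stereoNum]; ring
    rw [this]
    linear_combination -h3

/-- Complex coordinate on the plane orthogonal to the axis of the spinor `(a, b)`. -/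
noncomputable def planeCoord (a b : ℂ) : E3 →ₗ[ℝ] ℂ where
  toFun v := a ^ 2 * (v 0 + v 1 * Complex.I) - b ^ 2 * (v 0 - v 1 * Complex.I) - 2 * a * b * v 2
  map_add' u v := by simp; ring
  map_smul' c v := by simp; ring

theorem planeCoord_apply (a b : ℂ) (v : E3) : planeCoord a b v =
    a ^ 2 * (v 0 + v 1 * Complex.I) - b ^ 2 * (v 0 - v 1 * Complex.I) - 2 * a * b * v 2 := rfl

/-- Such a spinor gives the `SU(2)` matrix with rows `(a, b)` and `(-conj b, conj a)`, which rotates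
`N` to the third axis. Away from the south pole `a` can be taken real and positive. -/
theorem exists_spinor_of_unit {N : E3} (hN : N 0 ^ 2 + N 1 ^ 2 + N 2 ^ 2 = 1) :
    ∃ a b : ℂ, a * conj a + b * conj b = 1 ∧ a * conj a - b * conj b = N 2 ∧
      2 * a * conj b = N 0 - N 1 * Complex.I := by
  have hle : -1 ≤ N 2 := by nlinarith [sq_nonneg (N 0), sq_nonneg (N 1)]
  rcases hle.eq_or_lt with h | h
  · have h0 : N 0 = 0 := pow_eq_zero_iff two_ne_zero |>.1
      (by nlinarith [sq_nonneg (N 0), sq_nonneg (N 1)])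
    have h1 : N 1 = 0 := pow_eq_zero_iff two_ne_zero |>.1
      (by nlinarith [sq_nonneg (N 0), sq_nonneg (N 1)])
    exact ⟨0, 1, by simp, by simp [← h], by simp [h0, h1]⟩
  · set c := √((1 + N 2) / 2) with hc
    have hc0 : 0 < c := Real.sqrt_pos.2 (by linarith)
    have hc2 : 2 * c ^ 2 = 1 + N 2 := by
      rw [hc, Real.sq_sqrt (by linarith)]; ring
    have hcC : (c : ℂ) ≠ 0 := by exact_mod_cast hc0.ne'
    have hc2C : 2 * (c : ℂ) ^ 2 = 1 + N 2 := by
      simpa using congrArg Complex.ofReal hc2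
    have hNC : (N 0 : ℂ) ^ 2 + N 1 ^ 2 + N 2 ^ 2 = 1 := by
      simpa using congrArg Complex.ofReal hN
    have hb : ((N 0 + N 1 * Complex.I) / (2 * c) : ℂ) * ((N 0 - N 1 * Complex.I) / (2 * c)) =
        (1 - N 2) / 2 := by
      rw [div_mul_div_comm, div_eq_iff (by simp [hcC])]
      linear_combination hNC - (N 1 : ℂ) ^ 2 * Complex.I_sq - (1 - (N 2 : ℂ)) * hc2C
    have hconj : conj ((N 0 + N 1 * Complex.I) / (2 * c) : ℂ) =
        (N 0 - N 1 * Complex.I) / (2 * c) := by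
      simp [sub_eq_add_neg, map_ofNat]
    refine ⟨c, (N 0 + N 1 * Complex.I) / (2 * c), ?_, ?_, ?_⟩
    · rw [hconj, hb, Complex.conj_ofReal]
      linear_combination hc2C / 2
    · rw [hconj, hb, Complex.conj_ofReal]
      linear_combination hc2C / 2
    · rw [hconj]
      field_simp


theorem norm_planeCoord {N : E3} {a b : ℂ} (h1 : a * conj a + b * conj b = 1)
    (h2 : a * conj a - b * conj b = N 2) (h3 : 2 * a * conj b = N 0 - N 1 * Complex.I) {v : E3}
    (hv : N 0 * v 0 + N 1 * v 1 + N 2 * v 2 = 0) :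
    ‖planeCoord a b v‖ = √(∑ k, v k ^ 2) := by
  have hvC : (N 0 : ℂ) * v 0 + N 1 * v 1 + N 2 * v 2 = 0 := by
    simpa using congrArg Complex.ofReal hv
  have h3' : 2 * conj a * b = N 0 + N 1 * Complex.I := by
    have := congrArg conj h3
    simpa [map_ofNat] using this
  have hax : (v 2 : ℂ) * (a * conj a - b * conj b) + a * conj b * (v 0 + v 1 * Complex.I) +
      conj a * b * (v 0 - v 1 * Complex.I) = 0 := by
    linear_combination hvC + (v 2 : ℂ) * h2 + (v 0 + v 1 * Complex.I) / 2 * h3 +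
      (v 0 - v 1 * Complex.I) / 2 * h3' - N 1 * v 1 * Complex.I_sq
  have hconj : conj (planeCoord a b v) = conj a ^ 2 * (v 0 - v 1 * Complex.I) -
      conj b ^ 2 * (v 0 + v 1 * Complex.I) - 2 * conj a * conj b * v 2 := by
    simp [planeCoord_apply, sub_eq_add_neg, map_ofNat]
  have hsq : planeCoord a b v * conj (planeCoord a b v) = (v 0 : ℂ) ^ 2 + v 1 ^ 2 + v 2 ^ 2 := by
    rw [hconj, planeCoord_apply]
    generalize conj a = a' at *
    generalize conj b = b' at *
    -- The rotation preserves length: `‖planeCoord a b v‖² + (N · v)² = ‖v‖²`, as a polynomial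
    -- identity with `a'`, `b'` standing for the conjugates. The middle square vanishes by `hax`.
    have key : (a ^ 2 * (v 0 + v 1 * Complex.I) - b ^ 2 * (v 0 - v 1 * Complex.I) -
        2 * a * b * v 2) * (a' ^ 2 * (v 0 - v 1 * Complex.I) - b' ^ 2 * (v 0 + v 1 * Complex.I) -
        2 * a' * b' * v 2) + ((v 2 : ℂ) * (a * a' - b * b') + a * b' * (v 0 + v 1 * Complex.I) +
        a' * b * (v 0 - v 1 * Complex.I)) ^ 2 =
        ((v 0 + v 1 * Complex.I) * (v 0 - v 1 * Complex.I) + (v 2 : ℂ) ^ 2) *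
          (a * a' + b * b') ^ 2 := by ring
    rw [hax, h1] at key
    linear_combination key - (v 1 : ℂ) ^ 2 * Complex.I_sq
  symm
  rw [Real.sqrt_eq_iff_eq_sq (Finset.sum_nonneg fun _ _ => sq_nonneg _) (norm_nonneg _),
    Fin.sum_univ_three]
  rw [Complex.mul_conj'] at hsq
  exact_mod_cast hsq.symm

/-- After the rotation, the second component `w'` of every spinor has norm `√(1 / 2)`, and the first
is `w'` times the planar direction. Pulling out `w'` leaves the planar determinant. -/
theorem IsAtiyahChoice.norm_det_eq {x : Fin 4 → E3} {z w : Fin 4 → Fin 4 → ℂ}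
    (h : IsAtiyahChoice x z w) (hx : Function.Injective x) {N : E3} {a b : ℂ}
    (h1 : a * conj a + b * conj b = 1)
    (h2 : a * conj a - b * conj b = N 2) (h3 : 2 * a * conj b = N 0 - N 1 * Complex.I)
    (hN : ∀ i j, N 0 * (x j - x i) 0 + N 1 * (x j - x i) 1 + N 2 * (x j - x i) 2 = 0) :
    64 * ‖(atiyahMatrix z w).det‖ =
      ‖(atiyahMatrix (planarDir fun i => planeCoord a b (x i)) fun _ _ => 1).det‖ := by
  have h3' : 2 * conj a * b = N 0 + N 1 * Complex.I := by
    have := congrArg conj h3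
    simpa [map_ofNat] using this
  have hact := det_atiyahMatrix_linear a b (-conj b) (conj a) z w
  rw [show a * conj a - b * -conj b = 1 by linear_combination h1, one_pow, one_mul] at hact
  set w' : Fin 4 → Fin 4 → ℂ := fun i j => -conj b * z i j + conj a * w i j with hw'
  have main : ∀ i j, i ≠ j → ‖w' i j‖ = √(1 / 2) ∧ a * z i j + b * w i j =
      w' i j * planarDir (fun i => planeCoord a b (x i)) i j := by
    intro i j hij
    have hv := hN i j
    have hnorm := norm_planeCoord h1 h2 h3 hv
    set r := √(∑ k, (x j k - x i k) ^ 2) with hr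
    have hr0 : 0 < r := by
      refine Real.sqrt_pos.2 (lt_of_le_of_ne (Finset.sum_nonneg fun _ _ => sq_nonneg _) ?_)
      intro h0
      rw [eq_comm, Finset.sum_eq_zero_iff_of_nonneg fun _ _ => sq_nonneg _] at h0
      refine hij (hx ?_).symm
      ext k
      have := h0 k (Finset.mem_univ k)
      rw [pow_eq_zero_iff two_ne_zero] at this
      linarith
    have hrC : (r : ℂ) ≠ 0 := by exact_mod_cast hr0.ne'
    obtain ⟨e1, e2, e3⟩ := h.spinor hij hr.symm
    have e3' := congrArg conj e3
    rw [conj_stereoNum] at e3'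
    rw [stereoNum] at e3
    simp only [map_mul, Complex.conj_ofReal, Complex.conj_conj, map_ofNat] at e3'
    have hvC : (N 0 : ℂ) * (x j 0 - x i 0) + N 1 * (x j 1 - x i 1) + N 2 * (x j 2 - x i 2) = 0 := by
      simpa using congrArg Complex.ofReal hv
    push_cast at e1 e2 e3 e3'
    have cw : conj (w' i j) = -b * conj (z i j) + a * conj (w i j) := by simp [hw']
    -- A diagonal entry of the rotated `r + v · σ`: in general `2 r ‖w'‖² = r - N · v`, and `v` is
    -- orthogonal to `N`.
    have f2 : w' i j * conj (w' i j) = 1 / 2 := by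
      rw [cw, ← mul_left_inj' hrC, hw']
      linear_combination (b * conj b / 2) * e1 + (a * conj a / 2) * e2 -
        (a * conj b / 2) * e3 - (conj a * b / 2) * e3' + (r : ℂ) / 2 * h1 -
        ((x j 2 : ℂ) - x i 2) / 2 * h2 - (x j 0 - x i 0 + (x j 1 - x i 1) * Complex.I) / 4 * h3 -
        (x j 0 - x i 0 - (x j 1 - x i 1) * Complex.I) / 4 * h3' - hvC / 2 +
        N 1 * ((x j 1 : ℂ) - x i 1) / 2 * Complex.I_sq
    -- The off-diagonal entry of the same matrix.
    have f3 : 2 * (r : ℂ) * ((a * z i j + b * w i j) * conj (w' i j)) =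
        planeCoord a b (x j - x i) := by
      rw [cw, planeCoord_apply]
      simp only [PiLp.sub_apply]
      push_cast
      linear_combination (-a * b) * e1 + (a * b) * e2 + a ^ 2 * e3 - b ^ 2 * e3'
    refine ⟨?_, ?_⟩
    · rw [Complex.mul_conj'] at f2
      have : ‖w' i j‖ ^ 2 = 1 / 2 := by
        have := congrArg Complex.re f2
        rw [← Complex.ofReal_pow, Complex.ofReal_re] at this
        rw [this]; norm_num
      rw [← this, Real.sqrt_sq (norm_nonneg _)]
    · rw [planarDir, ← map_sub, hnorm]
      simp only [PiLp.sub_apply]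
      rw [← hr, ← f3]
      field_simp
      linear_combination (-2 * (a * z i j + b * w i j)) * f2
  rw [← hact, atiyahMatrix_congr (fun i j hij => (main i j hij).2)
    (w' := fun i j => w' i j * 1) (fun i j _ => (mul_one _).symm),
    norm_det_atiyahMatrix_mul _ _ _ _ fun i j hij => (main i j hij).1]
  rw [show (√(1 / 2 : ℝ)) ^ 12 = (√(1 / 2) ^ 2) ^ 6 by ring, Real.sq_sqrt (by norm_num)]
  ring

theorem Coplanar.exists_unit_normal {s : Set E3} (hs : Coplanar ℝ s) :
    ∃ N : E3, N 0 ^ 2 + N 1 ^ 2 + N 2 ^ 2 = 1 ∧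
      ∀ v ∈ vectorSpan ℝ s, N 0 * v 0 + N 1 * v 1 + N 2 * v 2 = 0 := by
  have hle := coplanar_iff_finrank_le_two.1 hs
  have hsum := (vectorSpan ℝ s).finrank_add_finrank_orthogonal
  rw [finrank_euclideanSpace_fin] at hsum
  have hne : (vectorSpan ℝ s)ᗮ ≠ ⊥ := by
    intro h
    rw [h, finrank_bot] at hsum
    omega
  obtain ⟨b, hb, hb0⟩ := Submodule.exists_mem_ne_zero_of_ne_bot hne
  have hn := norm_smul_inv_norm (𝕜 := ℝ) hb0
  set N : E3 := ((‖b‖ : ℝ)⁻¹) • b with hN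
  have hmem : N ∈ (vectorSpan ℝ s)ᗮ := Submodule.smul_mem _ _ hb
  refine ⟨N, ?_, fun v hv => ?_⟩
  · have : ‖N‖ ^ 2 = 1 := by
      rw [show ‖N‖ = 1 from hn]; norm_num
    rw [EuclideanSpace.norm_sq_eq, Fin.sum_univ_three] at this
    simpa using this
  · have := (Submodule.mem_orthogonal _ _).1 hmem v hv
    rw [PiLp.inner_apply, Fin.sum_univ_three] at this
    simpa using this

/-- The coordinate preserves lengths on the plane of the points, so a hull point with the same image
as `x i` is `x i`. -/
theorem ConvexIndependent.planeCoord {ι : Type*} {x : ι → E3} (hx : ConvexIndependent ℝ x) {N : E3}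
    {a b : ℂ} (h1 : a * conj a + b * conj b = 1) (h2 : a * conj a - b * conj b = N 2)
    (h3 : 2 * a * conj b = N 0 - N 1 * Complex.I)
    (hN : ∀ v ∈ vectorSpan ℝ (Set.range x), N 0 * v 0 + N 1 * v 1 + N 2 * v 2 = 0) :
    ConvexIndependent ℝ fun i => planeCoord a b (x i) := by
  intro s i hi
  rw [show (fun i => _root_.planeCoord a b (x i)) '' s = _root_.planeCoord a b '' (x '' s) from
    (Set.image_image _ _ _).symm, ← LinearMap.image_convexHull] at hi
  obtain ⟨y, hy, hyi⟩ := hi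
  have hspan : y - x i ∈ vectorSpan ℝ (Set.range x) := by
    rw [← direction_affineSpan]
    exact AffineSubspace.vsub_mem_direction
      (affineSpan_mono ℝ (Set.image_subset_range x s) (convexHull_subset_affineSpan _ hy))
      (subset_affineSpan ℝ _ (Set.mem_range_self i))
  have h0 := norm_planeCoord h1 h2 h3 (hN _ hspan)
  rw [map_sub, hyi, sub_self, norm_zero, eq_comm, Real.sqrt_eq_zero
    (Finset.sum_nonneg fun _ _ => sq_nonneg _),
    Finset.sum_eq_zero_iff_of_nonneg fun _ _ => sq_nonneg _] at h0
  have : y = x i := by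
    ext k
    have := pow_eq_zero_iff two_ne_zero |>.1 (h0 k (Finset.mem_univ k))
    simpa [sub_eq_zero] using this
  exact hx s i (this ▸ hy)

theorem theorem3p2 (x₁ x₂ x₃ x₄ : E3)
    (hx : AreVerticesOfConvexQuadrilateral ![x₁, x₂, x₃, x₄]) :
    1 ≤ ‖atiyahDet ![x₁, x₂, x₃, x₄]‖ := by
  obtain ⟨hcop, hconv⟩ := hx
  obtain ⟨N, hN1, hN⟩ := hcop.exists_unit_normal
  obtain ⟨a, b, h1, h2, h3⟩ := exists_spinor_of_unit hN1
  obtain ⟨zw, hzw⟩ := exists_isAtiyahChoice ![x₁, x₂, x₃, x₄]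
  have h64 := (hconv.planeCoord h1 h2 h3 hN).le_norm_det
  rw [atiyahDet_eq hzw]
  rw [← hzw.norm_det_eq hconv.injective h1 h2 h3 fun i j => hN _
    (vsub_mem_vectorSpan ℝ (Set.mem_range_self j) (Set.mem_range_self i))] at h64
  linarith
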